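/- Let $n\ge 0$ and let $c:\mathbb R^n\to\mathbb R\cup\{+\infty\}$ be a proper, lower semicontinuous (equivalently, closed) convex function; $\mathrm{dom}\,f=\{x : f(x)<+\infty\}$ denotes the effective domain of an extended-real-valued function $f$. Order $\mathbb R^n$ coordinatewise, with $x\wedge y$, $x\vee y$ the coordinatewise minimum and maximum, and $x^+=x\vee 0$, $x^-=(-x)\vee 0$. Write $f^*(p)=\sup_{q\in\mathbb R^n}\{p^\top q-f(q)\}$ for the convex conjugate and $\partial f(s)=\{p : f^*(p)+f(s)=p^\top s\}$ for the subdifferential. For functions $f,g$, write $f\le_Q g$ if for all $x\in\mathrm{dom}\,f$, $y\in\mathrm{dom}\,g$ and $\delta_1\in[0,(x-y)^+]$ there is $\delta_2\in[0,(x-y)^-]$ such that $$f(x-(\delta_1-\delta_2))+g(y+(\delta_1-\delta_2))\le f(x)+g(y).$$ For sets $X,Y\subseteq\mathbb R^I$ ($I$ finite), write $X\le_Q Y$ if for all $x\in X$, $y\in Y$ and $\delta_1\in[0,(x-y)^+]$ there is $\delta_2\in[0,(x-y)^-]$ such that $x-(\delta_1-\delta_2)\in X$ and $y+(\delta_1-\delta_2)\in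 Y$. A function $f$ is submodular if $f(p\wedge p')+f(p\vee p')\le f(p)+f(p')$ for all $p,p'\in\mathrm{dom}\,f$. For $I\subseteq\{1,\dots,n\}$ let $\pi_I$ be the projection of $\mathbb R^n$ onto $\mathbb R^I$, and let $\{p=p'\}$ denote the set of indices $i$ with $p_i=p'_i$. For $p,\bar q\in\mathbb R^n$ let $$r(p,\bar q)=\bar q-\operatorname*{argmax}_{q\le\bar q}\{p^\top q-c(q)\},$$ where the argmax is the (possibly empty) set of $q\in\mathrm{dom}\,c$ with $q\le\bar q$ at which $p^\top q-c(q)$ attains its maximum over $\{q\le\bar q\}$; in particular it is empty if no $q\le\bar q$ lies in $\mathrm{dom}\,c$. Then the following four assertions are equivalent: 1. $c$ is exchangeable, i.e. $c\le_Q c$; 2. $c^*$ is submodular; 3. for all $p\le p'$, $\ \pi_{\{p=p'\}}(\partial c^*(p'))\le_Q\pi_{\{p=p'\}}(\partial c^*(p))$; 4. for all $p\le p'$ and $\bar q\le\bar q'$, $\ \pi_{\{p=p'\}}(r(p,\bar q))\le_Q\pi_{\{p=p'\}}(r(p',\bar q'))$. -/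

import Mathlib

open scoped Matrix

namespace ExchangeMCS

noncomputable section

variable {ι : Type*}

/-- The effective domain `{x | f x < +∞}` of an extended-real-valued function. -/
def effDom (f : (ι → ℝ) → EReal) : Set (ι → ℝ) := {x | f x < ⊤}

/-- A proper function: it never takes the value `-∞`, and it is not identically `+∞`. -/
def IsProper (f : (ι → ℝ) → EReal) : Prop :=
  (∀ x, f x ≠ ⊥) ∧ (effDom f).Nonempty

/-- Convexity of an extended-real-valued function: its epigraph is convex. -/
def IsConvex (f : (ι → ℝ) → EReal) : Prop :=
  Convex ℝ {z : (ι → ℝ) × ℝ | f z.1 ≤ (z.2 : EReal)}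

/-- The Legendre transform `f*(p) = sup_q {pᵀq - f(q)}`. -/
def conj [Fintype ι] (f : (ι → ℝ) → EReal) (p : ι → ℝ) : EReal :=
  ⨆ q : ι → ℝ, ((p ⬝ᵥ q : ℝ) : EReal) - f q

/-- The subdifferential `∂f(s) = {p | f*(p) + f(s) = pᵀs}`. -/
def subdiff [Fintype ι] (f : (ι → ℝ) → EReal) (s : ι → ℝ) : Set (ι → ℝ) :=
  {p | conj f p + f s = ((p ⬝ᵥ s : ℝ) : EReal)}

/-- The Q-order `f ≤_Q g` on functions. -/
def FunQLE (f g : (ι → ℝ) → EReal) : Prop :=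
  ∀ x ∈ effDom f, ∀ y ∈ effDom g, ∀ δ₁ ∈ Set.Icc 0 (x - y)⁺, ∃ δ₂ ∈ Set.Icc 0 (x - y)⁻,
    f (x - (δ₁ - δ₂)) + g (y + (δ₁ - δ₂)) ≤ f x + g y

/-- A function is exchangeable if it is below itself in the Q-order. -/
def IsExchangeable (f : (ι → ℝ) → EReal) : Prop := FunQLE f f

/-- The P-order `f ≤_P g` on functions. -/
def FunPLE (f g : (ι → ℝ) → EReal) : Prop :=
  ∀ x ∈ effDom f, ∀ y ∈ effDom g, f (x ⊓ y) + g (x ⊔ y) ≤ f x + g y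

/-- A function is submodular if it is below itself in the P-order. -/
def IsSubmodular (f : (ι → ℝ) → EReal) : Prop := FunPLE f f

/-- The Q-order `X ≤_Q Y` on sets. -/
def SetQLE (X Y : Set (ι → ℝ)) : Prop :=
  ∀ x ∈ X, ∀ y ∈ Y, ∀ δ₁ ∈ Set.Icc 0 (x - y)⁺, ∃ δ₂ ∈ Set.Icc 0 (x - y)⁻,
    x - (δ₁ - δ₂) ∈ X ∧ y + (δ₁ - δ₂) ∈ Y

/-- The projection `π_I(X) ⊆ ℝ^I` of a set `X` onto the coordinates in `I`. -/
def proj (I : Set ι) (X : Set (ι → ℝ)) : Set (I → ℝ) :=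
  (fun x (i : I) => x i) '' X

/-- The set `{p = p'}` of coordinates in which `p` and `p'` agree. -/
def agree (p p' : ι → ℝ) : Set ι := {i | p i = p' i}

/-- The set `argmax_{q ≤ q̄} {pᵀq - c(q)}`. Maximizers are points of the domain of `c`; in
particular the set is empty when no `q ≤ q̄` lies in the domain. -/
def demand [Fintype ι] (c : (ι → ℝ) → EReal) (p qbar : ι → ℝ) : Set (ι → ℝ) :=
  {q | q ≤ qbar ∧ q ∈ effDom c ∧
    ∀ q' ≤ qbar, ((p ⬝ᵥ q' : ℝ) : EReal) - c q' ≤ ((p ⬝ᵥ q : ℝ) : EReal) - c q}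

/-- The rejected quantities `r(p, q̄) = q̄ - argmax_{q ≤ q̄} {pᵀq - c(q)}`. -/
def rejected [Fintype ι] (c : (ι → ℝ) → EReal) (p qbar : ι → ℝ) : Set (ι → ℝ) :=
  (fun q => qbar - q) '' demand c p qbar

end

end ExchangeMCS

/-!
If the conjugate is submodular but no exchange of `δ₁` between `x` and `y` is cheap enough, the
compact convex set of exchanged pairs can be separated from the epigraph of `c x + c y` by prices
`(p, p')`; sorting them into `(p ⊓ p', p ⊔ p')` then contradicts Fenchel's inequality at `y`, `x`.

An exchange whose `δ₁` is supported on `{p = p'}` with `p ≤ p'` does not lower the total surplus, so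
an exchangeable `c` lets two optimal bundles exchange while both remain optimal and below their
caps. By Fenchel–Moreau, `∂c*(p)` consists of the unconstrained maximisers of `pᵀq - c(q)`, and
`x ∈ ∂c*(p')`, `y ∈ ∂c*(p)` are demanded under the cap `x ⊔ y`: this carries exchange of rejected
quantities over to exchange of subgradients.

Let `f = c*`, let `d, w ≥ 0` have disjoint supports and let `p` be in the relative interior of
`dom f`. Minimising `f` plus a penalty over the box `[p - w, p]`, the Kuhn–Tucker conditions give a
subgradient which can be exchanged with one at `p`; this yields
`f (p - w) - f (p + d - w) ≤ f (p - d) - f p`, which misses submodularity by one step `d`. Summing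
over a subdivision of `d` and refining it removes the gap, and lower semicontinuity reaches the
relative boundary.
-/

namespace ExchangeMCS

open AffineMap Filter Topology

section RelCore

variable {E : Type*} [AddCommGroup E] [Module ℝ E] {C : Set E} {p v : E}

/-- The relative algebraic interior of `C`: the points of `C` from which one can move slightly
away from any other point of `C` without leaving `C`. In finite dimension this is the relative
interior. -/
def relCore (C : Set E) : Set E :=
  {p ∈ C | ∀ v ∈ C, ∃ ε > 0, lineMap p v (-ε : ℝ) ∈ C}

lemma lineMap_mem_relCore (hC : Convex ℝ C) (hp : p ∈ relCore C) (hv : v ∈ C) {t : ℝ}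
    (ht : t ∈ Set.Ico 0 1) : lineMap p v t ∈ relCore C := by
  refine ⟨hC.lineMap_mem hp.1 hv (Set.Ico_subset_Icc_self ht), fun u hu => ?_⟩
  obtain ⟨ε, hε, hpu⟩ := hp.2 u hu
  have hd : 0 < 1 + ε * t := by nlinarith [ht.1]
  have ht' : 0 < 1 - t := sub_pos.2 ht.2
  refine ⟨ε * (1 - t) / (1 + ε * t), by positivity, ?_⟩
  have hmem := hC hpu hv (a := (1 - t) / (1 + ε * t)) (b := t * (1 + ε) / (1 + ε * t))
    (by positivity) (div_nonneg (mul_nonneg ht.1 (by linarith)) hd.le)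
    (by rw [← add_div, div_eq_one_iff_eq hd.ne']; ring)
  convert hmem using 1
  simp only [lineMap_apply_module]
  match_scalars <;> field_simp <;> ring

lemma eq_zero_of_mem_relCore {A : E →ᵃ[ℝ] ℝ} (hp : p ∈ relCore C) (hA : ∀ v ∈ C, 0 ≤ A v)
    (hAp : A p ≤ 0) (hv : v ∈ C) : A v = 0 := by
  obtain ⟨ε, hε, h⟩ := hp.2 v hv
  have h' := hA _ h
  rw [apply_lineMap, lineMap_apply_ring'] at h'
  nlinarith [hA v hv]

lemma mem_relCore_inter_zero {A : E →ᵃ[ℝ] ℝ} (hp : p ∈ relCore C) (hAp : A p = 0) :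
    p ∈ relCore {v ∈ C | A v = 0} := by
  refine ⟨⟨hp.1, hAp⟩, fun v hv => ?_⟩
  obtain ⟨ε, hε, h⟩ := hp.2 v hv.1
  refine ⟨ε, hε, h, ?_⟩
  rw [apply_lineMap, hAp, hv.2, lineMap_same_apply]

lemma relCore_neg : relCore (-C) = -relCore C := by
  have hneg (p v : E) (t : ℝ) : -lineMap p v t = lineMap (-p) (-v) t := by
    simp only [lineMap_apply_module]
    module
  ext p
  simp only [relCore, Set.mem_sep_iff, Set.mem_neg, hneg]
  exact and_congr_right fun _ => ⟨fun h v hv => by simpa using h (-v) (by simpa using hv),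
    fun h v hv => h (-v) hv⟩

end RelCore

lemma relCore_nonempty {E : Type*} [NormedAddCommGroup E] [NormedSpace ℝ E]
    [FiniteDimensional ℝ E] {C : Set E} (hC : Convex ℝ C) (hne : C.Nonempty) :
    (relCore C).Nonempty := by
  obtain ⟨_, hp⟩ := hne.intrinsicInterior hC
  obtain ⟨p, hpint, rfl⟩ := mem_intrinsicInterior.1 hp
  refine ⟨p, intrinsicInterior_subset hp, fun v hv => ?_⟩
  let line (ε : ℝ) : affineSpan ℝ C :=
    ⟨lineMap (p : E) v (-ε), lineMap_mem _ p.2 (subset_affineSpan ℝ C hv)⟩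
  have hline : Continuous line := (lineMap_continuous.comp continuous_neg).subtype_mk _
  have hline0 : line 0 = p := by ext; simp [line]
  have hnhds : ∀ᶠ ε in 𝓝 0, (line ε : E) ∈ C :=
    hline.continuousAt (hline0 ▸ mem_interior_iff_mem_nhds.1 hpint)
  obtain ⟨ε, hε, hmem⟩ :=
    ((hnhds.filter_mono nhdsWithin_le_nhds).and (self_mem_nhdsWithin (s := Set.Ioi 0))).exists
      |>.imp fun _ h => And.symm h
  exact ⟨ε, hε, hmem⟩

section Multipliers

variable {E J : Type*} [AddCommGroup E] [Module ℝ E] {C : Set E} {p : E} {g : E → ℝ}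

lemma convexOn_affineMap (hC : Convex ℝ C) (A : E →ᵃ[ℝ] ℝ) : ConvexOn ℝ C A :=
  ⟨hC, fun _ _ _ _ _ _ _ _ h => (Convex.combo_affine_apply h).le⟩

lemma sum_smul_affineMap_apply (s : Finset J) (l : J → ℝ) (a : J → E →ᵃ[ℝ] ℝ) (v : E) :
    (∑ j ∈ s, l j • a j) v = ∑ j ∈ s, l j * a j v :=
  map_sum (AddMonoidHom.mk' (fun A : E →ᵃ[ℝ] ℝ => A v) fun _ _ => rfl) _ s

lemma neg_div_le_div_neg_of_nonneg_of_eq_zero {A : E →ᵃ[ℝ] ℝ} (hg : ConvexOn ℝ C g)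
    (hzero : ∀ v ∈ C, A v = 0 → 0 ≤ g v) {x y : E} (hx : x ∈ C) (hy : y ∈ C) (hAx : 0 < A x)
    (hAy : A y < 0) : -g x / A x ≤ g y / -A y := by
  have hAy' : 0 < -A y := neg_pos.2 hAy
  have hd : 0 < A x + -A y := add_pos hAx hAy'
  have hα : 0 ≤ -A y / (A x + -A y) := by positivity
  have hβ : 0 ≤ A x / (A x + -A y) := by positivity
  have hαβ : -A y / (A x + -A y) + A x / (A x + -A y) = 1 := by field_simp; ring
  have hA : A ((-A y / (A x + -A y)) • x + (A x / (A x + -A y)) • y) = 0 := by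
    rw [Convex.combo_affine_apply hαβ, smul_eq_mul, smul_eq_mul]
    ring
  have h := (hzero _ (hg.1 hx hy hα hβ hαβ) hA).trans (hg.2 hx hy hα hβ hαβ)
  rw [smul_eq_mul, smul_eq_mul, div_mul_eq_mul_div, div_mul_eq_mul_div, ← add_div,
    le_div_iff₀ hd] at h
  rw [div_le_div_iff₀ hAx hAy']
  linarith

lemma exists_multiplier_of_pos_of_neg {A : E →ᵃ[ℝ] ℝ} (hg : ConvexOn ℝ C g)
    (hzero : ∀ v ∈ C, A v = 0 → 0 ≤ g v) (hpos : ∃ x ∈ C, 0 < A x) (hneg : ∃ y ∈ C, A y < 0) :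
    ∃ μ : ℝ, ∀ v ∈ C, 0 ≤ g v + μ * A v := by
  obtain ⟨x, hx, hAx⟩ := hpos
  obtain ⟨y, hy, hAy⟩ := hneg
  obtain ⟨μ, hlow, hupp⟩ := exists_between_of_forall_le
    (s := (fun v => -g v / A v) '' {v ∈ C | 0 < A v})
    (t := (fun v => g v / -A v) '' {v ∈ C | A v < 0}) ⟨_, x, ⟨hx, hAx⟩, rfl⟩
    ⟨_, y, ⟨hy, hAy⟩, rfl⟩ (by
      rintro _ ⟨u, ⟨hu, hAu⟩, rfl⟩ _ ⟨v, ⟨hv, hAv⟩, rfl⟩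
      exact neg_div_le_div_neg_of_nonneg_of_eq_zero hg hzero hu hv hAu hAv)
  refine ⟨μ, fun v hv => ?_⟩
  rcases lt_trichotomy (A v) 0 with hAv | hAv | hAv
  · have := hupp ⟨v, ⟨hv, hAv⟩, rfl⟩
    rw [le_div_iff₀ (neg_pos.2 hAv)] at this
    linarith
  · rw [hAv, mul_zero, add_zero]
    exact hzero v hv hAv
  · have := hlow ⟨v, ⟨hv, hAv⟩, rfl⟩
    rw [div_le_iff₀ hAv] at this
    linarith

lemma exists_multiplier_eq {A : E →ᵃ[ℝ] ℝ} (hp : p ∈ relCore C) (hg : ConvexOn ℝ C g)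
    (hAp : A p = 0) (hzero : ∀ v ∈ C, A v = 0 → 0 ≤ g v) :
    ∃ μ : ℝ, ∀ v ∈ C, 0 ≤ g v + μ * A v := by
  have hopp (v) (hv : v ∈ C) : ∃ ε > 0, ∃ u ∈ C, A u = -(ε * A v) := by
    obtain ⟨ε, hε, h⟩ := hp.2 v hv
    refine ⟨ε, hε, _, h, ?_⟩
    rw [apply_lineMap, hAp, lineMap_apply_ring']
    ring
  by_cases hpos : ∃ x ∈ C, 0 < A x
  · obtain ⟨x, hx, hAx⟩ := hpos
    obtain ⟨ε, hε, y, hy, hAy⟩ := hopp x hx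
    exact exists_multiplier_of_pos_of_neg hg hzero ⟨x, hx, hAx⟩
      ⟨y, hy, hAy ▸ neg_neg_of_pos (mul_pos hε hAx)⟩
  · push Not at hpos
    have hA := fun v hv => eq_zero_of_mem_relCore (A := -A) (v := v) hp
      (fun v hv => neg_nonneg.2 (hpos v hv)) (neg_nonpos.2 hAp.ge) hv
    refine ⟨0, fun v hv => ?_⟩
    rw [zero_mul, add_zero]
    exact hzero v hv (neg_eq_zero.1 (hA v hv))

lemma exists_multiplier_le {A : E →ᵃ[ℝ] ℝ} (hg : ConvexOn ℝ C g)
    (hnonpos : ∀ v ∈ C, A v ≤ 0 → 0 ≤ g v) (hslater : ∃ y ∈ C, A y < 0) :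
    ∃ μ : ℝ, 0 ≤ μ ∧ ∀ v ∈ C, 0 ≤ g v + μ * A v := by
  by_cases hpos : ∃ x ∈ C, 0 < A x
  · obtain ⟨μ, hμ⟩ := exists_multiplier_of_pos_of_neg hg (fun v hv h => hnonpos v hv h.le)
      hpos hslater
    refine ⟨max μ 0, le_max_right _ _, fun v hv => ?_⟩
    rcases le_total (A v) 0 with hAv | hAv
    · rcases le_total μ 0 with h | h
      · rw [max_eq_right h, zero_mul, add_zero]
        exact hnonpos v hv hAv
      · rw [max_eq_left h]
        exact hμ v hv
    · linarith [hμ v hv, mul_le_mul_of_nonneg_right (le_max_left μ 0) hAv]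
  · push Not at hpos
    exact ⟨0, le_rfl, fun v hv => by simpa using hnonpos v hv (hpos v hv)⟩

lemma exists_multipliers_of_add_sum_nonneg {s : Finset J} {a : J → E →ᵃ[ℝ] ℝ}
    {A : E →ᵃ[ℝ] ℝ} {m : J → ℝ} (hp : p ∈ relCore C) (hg : ConvexOn ℝ C g)
    (hap : ∀ j ∈ s, a j p ≤ 0) (hAp : A p ≤ 0) (hm : 0 ≤ m)
    (hA : ∀ v ∈ C, 0 ≤ A v + ∑ j ∈ s, m j * a j v)
    (hzero : ∃ l : J → ℝ, 0 ≤ l ∧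
      ∀ v ∈ {v ∈ C | A v = 0}, 0 ≤ g v + ∑ j ∈ s, l j * a j v) :
    ∃ μ : ℝ, 0 ≤ μ ∧ ∃ l : J → ℝ, 0 ≤ l ∧
      ∀ v ∈ C, 0 ≤ g v + (μ * A v + ∑ j ∈ s, l j * a j v) := by
  obtain ⟨l, hl, hlg⟩ := hzero
  have hmp : ∑ j ∈ s, m j * a j p ≤ 0 :=
    Finset.sum_nonpos fun j hj => mul_nonpos_of_nonneg_of_nonpos (hm j) (hap j hj)
  have hAm (v) (hv : v ∈ C) : A v + ∑ j ∈ s, m j * a j v = 0 := by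
    have := eq_zero_of_mem_relCore (A := A + ∑ j ∈ s, m j • a j) hp
      (fun v hv => by simpa [sum_smul_affineMap_apply] using hA v hv)
      (by simpa [sum_smul_affineMap_apply] using add_nonpos hAp hmp) hv
    simpa [sum_smul_affineMap_apply] using this
  have hconv : ConvexOn ℝ C fun v => g v + ∑ j ∈ s, l j * a j v := by
    simp only [← sum_smul_affineMap_apply]
    exact hg.add (convexOn_affineMap hg.1 _)
  obtain ⟨μ, hμ⟩ := exists_multiplier_eq hp hconv (by linarith [hAm p hp.1])
    fun v hv hAv => hlg v ⟨hv, hAv⟩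
  refine ⟨μ⁺, posPart_nonneg μ, l + μ⁻ • m,
    add_nonneg hl (smul_nonneg (negPart_nonneg μ) hm), fun v hv => ?_⟩
  calc 0 ≤ g v + ∑ j ∈ s, l j * a j v + (μ⁺ - μ⁻) * A v := by
        rw [posPart_sub_negPart]; exact hμ v hv
    _ = g v + (μ⁺ * A v + (∑ j ∈ s, l j * a j v + μ⁻ * ∑ j ∈ s, m j * a j v)) := by
        rw [← neg_eq_iff_add_eq_zero.2 (hAm v hv)]; ring
    _ = _ := by
        simp only [Pi.add_apply, Pi.smul_apply, smul_eq_mul, add_mul, Finset.sum_add_distrib,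
          Finset.mul_sum, mul_assoc]

lemma sum_insert_update_mul [DecidableEq J] {s : Finset J} {j₀ : J} (hj₀ : j₀ ∉ s)
    (l b : J → ℝ) (μ : ℝ) :
    ∑ j ∈ insert j₀ s, Function.update l j₀ μ j * b j = μ * b j₀ + ∑ j ∈ s, l j * b j := by
  rw [Finset.sum_insert hj₀, Function.update_self]
  congr 1
  refine Finset.sum_congr rfl fun j hj => ?_
  rw [Function.update_of_ne (ne_of_mem_of_not_mem hj hj₀)]

lemma convex_setOf_forall_affineMap_le_zero (hC : Convex ℝ C) (s : Finset J)
    (a : J → E →ᵃ[ℝ] ℝ) : Convex ℝ {v ∈ C | ∀ j ∈ s, a j v ≤ 0} :=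
  fun _ hx _ hy _ _ hα hβ hαβ => ⟨hC hx.1 hy.1 hα hβ hαβ, fun j hj =>
    ((convexOn_affineMap hC (a j)).convex_le 0 ⟨hx.1, hx.2 j hj⟩ ⟨hy.1, hy.2 j hj⟩ hα hβ hαβ).2⟩

/-- Since `p` lies in the relative interior, no Slater point is needed: a constraint which is
nonnegative on the set cut out by the others behaves like an equation. -/
lemma exists_multipliers (hp : p ∈ relCore C) (hg : ConvexOn ℝ C g) (s : Finset J)
    (a : J → E →ᵃ[ℝ] ℝ) (hap : ∀ j ∈ s, a j p ≤ 0)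
    (hnonneg : ∀ v ∈ C, (∀ j ∈ s, a j v ≤ 0) → 0 ≤ g v) :
    ∃ l : J → ℝ, 0 ≤ l ∧ ∀ v ∈ C, 0 ≤ g v + ∑ j ∈ s, l j * a j v := by
  classical
  induction s using Finset.induction_on generalizing C g with
  | empty => exact ⟨0, le_rfl, by simpa using hnonneg⟩
  | insert j₀ s hj₀ ih =>
    simp only [Finset.forall_mem_insert] at hap hnonneg
    suffices ∃ μ : ℝ, 0 ≤ μ ∧ ∃ l : J → ℝ, 0 ≤ l ∧
        ∀ v ∈ C, 0 ≤ g v + (μ * a j₀ v + ∑ j ∈ s, l j * a j v) by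
      obtain ⟨μ, hμ, l, hl, hgl⟩ := this
      exact ⟨Function.update l j₀ μ, le_update_iff.2 ⟨hμ, fun j _ => hl j⟩, fun v hv => by
        rw [sum_insert_update_mul hj₀ l (a · v)]; exact hgl v hv⟩
    by_cases hslater : ∃ y ∈ {v ∈ C | ∀ j ∈ s, a j v ≤ 0}, a j₀ y < 0
    · obtain ⟨μ, hμ, hgμ⟩ := exists_multiplier_le (hg.subset (Set.sep_subset _ _)
        (convex_setOf_forall_affineMap_le_zero hg.1 s a))
        (fun v hv h => hnonneg v hv.1 ⟨h, hv.2⟩) hslater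
      obtain ⟨l, hl, hgl⟩ := ih hp (hg.add (convexOn_affineMap hg.1 (μ • a j₀))) hap.2
        fun v hv h => hgμ v ⟨hv, h⟩
      exact ⟨μ, hμ, l, hl, fun v hv => by rw [← add_assoc]; exact hgl v hv⟩
    · push Not at hslater
      obtain ⟨m, hm, hgm⟩ := ih hp (convexOn_affineMap hg.1 (a j₀)) hap.2
        fun v hv h => hslater v ⟨hv, h⟩
      have hap₀ : a j₀ p = 0 := hap.1.antisymm (hslater p ⟨hp.1, hap.2⟩)
      have hzero : Convex ℝ {v ∈ C | a j₀ v = 0} :=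
        hg.1.inter ((convex_singleton (0 : ℝ)).affine_preimage (a j₀))
      exact exists_multipliers_of_add_sum_nonneg hp hg hap.2 hap.1 hm hgm
        (ih (mem_relCore_inter_zero hp hap₀) (hg.subset (Set.sep_subset _ _) hzero) hap.2
          fun v hv h => hnonneg v hv.1 ⟨hv.2.le, h⟩)

lemma exists_multipliers_of_isMinOn (hp : p ∈ relCore C) (hg : ConvexOn ℝ C g) (s : Finset J)
    (a : J → E →ᵃ[ℝ] ℝ) (hap : ∀ j ∈ s, a j p ≤ 0) {z : E}
    (hz : z ∈ {v ∈ C | ∀ j ∈ s, a j v ≤ 0}) (hmin : IsMinOn g {v ∈ C | ∀ j ∈ s, a j v ≤ 0} z) :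
    ∃ l : J → ℝ, 0 ≤ l ∧ (∀ j ∈ s, l j * a j z = 0) ∧
      ∀ v ∈ C, g z ≤ g v + ∑ j ∈ s, l j * a j v := by
  obtain ⟨l, hl, hgl⟩ := exists_multipliers hp (hg.add_const (-g z)) s a hap fun v hv h => by
    simpa using hmin ⟨hv, h⟩
  have hgl' (v) (hv : v ∈ C) : g z ≤ g v + ∑ j ∈ s, l j * a j v := by
    have : 0 ≤ g v + -g z + ∑ j ∈ s, l j * a j v := hgl v hv
    linarith
  have hterm (j) (hj : j ∈ s) : l j * a j z ≤ 0 :=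
    mul_nonpos_of_nonneg_of_nonpos (hl j) (hz.2 j hj)
  have hsum : ∑ j ∈ s, l j * a j z = 0 :=
    (Finset.sum_nonpos hterm).antisymm (le_add_iff_nonneg_right _ |>.1 (hgl' z hz.1))
  exact ⟨l, hl, (Finset.sum_eq_zero_iff_of_nonpos hterm).1 hsum, hgl'⟩

end Multipliers

section ExtendedReal

variable {ι : Type*} {f : (ι → ℝ) → EReal} {x y a b : ι → ℝ} {r : ℝ}

lemma coe_toReal_of_mem_effDom (hbot : ∀ x, f x ≠ ⊥) (hx : x ∈ effDom f) :
    ((f x).toReal : EReal) = f x :=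
  EReal.coe_toReal (ne_of_lt hx) (hbot x)

lemma eq_top_of_notMem_effDom (hx : x ∉ effDom f) : f x = ⊤ := not_lt_top_iff.1 hx

lemma le_coe_iff (hbot : ∀ x, f x ≠ ⊥) : f x ≤ r ↔ x ∈ effDom f ∧ (f x).toReal ≤ r := by
  by_cases hx : x ∈ effDom f
  · rw [← coe_toReal_of_mem_effDom hbot hx]
    simp [hx]
  · simp [eq_top_of_notMem_effDom hx, hx]

lemma add_le_coe_iff (hbot : ∀ x, f x ≠ ⊥) :
    f x + f y ≤ r ↔ x ∈ effDom f ∧ y ∈ effDom f ∧ (f x).toReal + (f y).toReal ≤ r := by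
  by_cases hx : x ∈ effDom f
  · by_cases hy : y ∈ effDom f
    · rw [← coe_toReal_of_mem_effDom hbot hx, ← coe_toReal_of_mem_effDom hbot hy,
        ← EReal.coe_add, EReal.coe_le_coe_iff]
      simp [hx, hy]
    · simp [eq_top_of_notMem_effDom hy, EReal.add_top_of_ne_bot (hbot x), hy]
  · simp [eq_top_of_notMem_effDom hx, EReal.top_add_of_ne_bot (hbot y), hx]

lemma add_le_add_iff_toReal (hbot : ∀ x, f x ≠ ⊥) :
    f x + f y ≤ f a + f b ↔ (a ∈ effDom f → b ∈ effDom f →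
      x ∈ effDom f ∧ y ∈ effDom f ∧
        (f x).toReal + (f y).toReal ≤ (f a).toReal + (f b).toReal) := by
  by_cases ha : a ∈ effDom f
  · by_cases hb : b ∈ effDom f
    · simp only [ha, hb, forall_const]
      rw [← add_le_coe_iff hbot, EReal.coe_add, coe_toReal_of_mem_effDom hbot ha,
        coe_toReal_of_mem_effDom hbot hb]
    · simp [eq_top_of_notMem_effDom hb, EReal.add_top_of_ne_bot (hbot a), hb]
  · simp [eq_top_of_notMem_effDom ha, EReal.top_add_of_ne_bot (hbot b), ha]

lemma isSubmodular_iff (hbot : ∀ x, f x ≠ ⊥) :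
    IsSubmodular f ↔ ∀ x ∈ effDom f, ∀ y ∈ effDom f, x ⊓ y ∈ effDom f ∧ x ⊔ y ∈ effDom f ∧
      (f (x ⊓ y)).toReal + (f (x ⊔ y)).toReal ≤ (f x).toReal + (f y).toReal := by
  refine forall₄_congr fun x hx y hy => ?_
  simp only [add_le_add_iff_toReal hbot, hx, hy, forall_const]

lemma isExchangeable_iff (hbot : ∀ x, f x ≠ ⊥) :
    IsExchangeable f ↔ ∀ x ∈ effDom f, ∀ y ∈ effDom f, ∀ δ₁ ∈ Set.Icc 0 (x - y)⁺,
      ∃ δ₂ ∈ Set.Icc 0 (x - y)⁻, x - (δ₁ - δ₂) ∈ effDom f ∧ y + (δ₁ - δ₂) ∈ effDom f ∧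
        (f (x - (δ₁ - δ₂))).toReal + (f (y + (δ₁ - δ₂))).toReal
          ≤ (f x).toReal + (f y).toReal := by
  refine forall₄_congr fun x hx y hy => forall₂_congr fun δ₁ _ => exists_congr fun δ₂ =>
    and_congr_right fun _ => ?_
  simp only [add_le_add_iff_toReal hbot, hx, hy, forall_const]

lemma IsConvex.convexOn_toReal (hf : IsConvex f) (hbot : ∀ x, f x ≠ ⊥) :
    ConvexOn ℝ (effDom f) fun x => (f x).toReal := by
  rw [convexOn_iff_convex_epigraph]
  simpa only [IsConvex, le_coe_iff hbot] using hf

lemma lowerSemicontinuous_add_prod (hbot : ∀ x, f x ≠ ⊥) (hf : LowerSemicontinuous f) :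
    LowerSemicontinuous fun z : (ι → ℝ) × (ι → ℝ) => f z.1 + f z.2 :=
  (hf.comp continuous_fst).add' (hf.comp continuous_snd) fun _ =>
    EReal.continuousAt_add (Or.inr (hbot _)) (Or.inl (hbot _))

lemma convex_epigraph_add_prod (hbot : ∀ x, f x ≠ ⊥) (hconv : IsConvex f) :
    Convex ℝ {z : ((ι → ℝ) × (ι → ℝ)) × ℝ | f z.1.1 + f z.1.2 ≤ z.2} := by
  have hφ := hconv.convexOn_toReal hbot
  have hfst := (hφ.comp_linearMap (.fst ℝ (ι → ℝ) (ι → ℝ))).subset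
    (Set.prod_subset_preimage_fst _ (effDom f)) (hφ.1.prod hφ.1)
  have hsnd := (hφ.comp_linearMap (.snd ℝ (ι → ℝ) (ι → ℝ))).subset
    (Set.prod_subset_preimage_snd (effDom f) _) (hφ.1.prod hφ.1)
  have hadd : ConvexOn ℝ (effDom f ×ˢ effDom f)
      fun z : (ι → ℝ) × (ι → ℝ) => (f z.1).toReal + (f z.2).toReal := hfst.add hsnd
  simpa only [add_le_coe_iff hbot, Set.mem_prod, and_assoc] using hadd.convex_epigraph

lemma le_coe_of_tendsto_of_lowerSemicontinuous {α X : Type*} [TopologicalSpace X]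
    {F : X → EReal} (hF : LowerSemicontinuous F) {l : Filter α} [l.NeBot] {u : α → X}
    {s : α → ℝ} {a : X}
    (hu : Tendsto u l (𝓝 a)) (hs : Tendsto s l (𝓝 r)) (h : ∀ᶠ k in l, F (u k) ≤ s k) :
    F a ≤ r :=
  hF.isClosed_epigraph.mem_of_tendsto
    (hu.prodMk_nhds ((continuous_coe_real_ereal.tendsto r).comp hs)) h

lemma exists_isMinOn_toReal_add (hbot : ∀ x, f x ≠ ⊥) (hf : LowerSemicontinuous f)
    {K : Set (ι → ℝ)} (hK : IsCompact K) (hne : (effDom f ∩ K).Nonempty) {g : (ι → ℝ) → ℝ}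
    (hg : Continuous g) :
    ∃ z ∈ effDom f ∩ K, IsMinOn (fun v => (f v).toReal + g v) (effDom f ∩ K) z := by
  obtain ⟨v₀, hv₀, hv₀K⟩ := hne
  have hlsc : LowerSemicontinuous fun v => f v + (g v : EReal) :=
    hf.add' (continuous_coe_real_ereal.comp hg).lowerSemicontinuous fun _ =>
      EReal.continuousAt_add (Or.inr (EReal.coe_ne_bot _)) (Or.inr (EReal.coe_ne_top _))
  obtain ⟨z, hzK, hz⟩ := (hlsc.lowerSemicontinuousOn K).exists_isMinOn ⟨v₀, hv₀K⟩ hK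
  have hle (v) (hv : v ∈ effDom f ∩ K) :
      f z ≤ (((f v).toReal + g v - g z : ℝ) : EReal) := by
    have : f z + g z ≤ f v + g v := hz hv.2
    rw [EReal.coe_sub, EReal.coe_add, coe_toReal_of_mem_effDom hbot hv.1]
    exact (EReal.le_sub_iff_add_le (Or.inl (EReal.coe_ne_bot _))
      (Or.inl (EReal.coe_ne_top _))).2 this
  refine ⟨z, ⟨((le_coe_iff hbot).1 (hle v₀ ⟨hv₀, hv₀K⟩)).1, hzK⟩, fun v hv => ?_⟩
  exact le_sub_iff_add_le.1 ((le_coe_iff hbot).1 (hle v hv)).2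

end ExtendedReal

section Conjugate

variable {ι : Type*} [Fintype ι] {f : (ι → ℝ) → EReal} {p q : ι → ℝ}

lemma conj_le_coe_iff (hbot : ∀ x, f x ≠ ⊥) {r : ℝ} :
    conj f p ≤ r ↔ ∀ q ∈ effDom f, p ⬝ᵥ q - (f q).toReal ≤ r := by
  rw [conj, iSup_le_iff]
  refine forall_congr' fun q => ?_
  by_cases hq : q ∈ effDom f
  · simp only [hq, forall_const]
    rw [← EReal.coe_le_coe_iff, EReal.coe_sub, coe_toReal_of_mem_effDom hbot hq]
  · simp [eq_top_of_notMem_effDom hq, hq]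

lemma conj_ne_bot (hf : IsProper f) (p : ι → ℝ) : conj f p ≠ ⊥ := by
  obtain ⟨q, hq⟩ := hf.2
  have h : (p ⬝ᵥ q : ℝ) - f q ≤ conj f p := le_iSup (fun q => ((p ⬝ᵥ q : ℝ) : EReal) - f q) q
  rw [← coe_toReal_of_mem_effDom hf.1 hq, ← EReal.coe_sub] at h
  exact ne_bot_of_le_ne_bot (EReal.coe_ne_bot _) h

lemma dotProduct_le_conj_add (hf : IsProper f) (hp : p ∈ effDom (conj f)) (hq : q ∈ effDom f) :
    p ⬝ᵥ q ≤ (conj f p).toReal + (f q).toReal :=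
  sub_le_iff_le_add.1
    ((conj_le_coe_iff hf.1).1 (coe_toReal_of_mem_effDom (conj_ne_bot hf) hp).ge q hq)

lemma mem_subdiff_iff (hf : IsProper f) :
    q ∈ subdiff f p ↔
      p ∈ effDom f ∧ ∀ v ∈ effDom f, (f p).toReal + q ⬝ᵥ (v - p) ≤ (f v).toReal := by
  by_cases hp : p ∈ effDom f
  · calc q ∈ subdiff f p
      _ ↔ conj f q = ((q ⬝ᵥ p - (f p).toReal : ℝ) : EReal) := by
        rw [subdiff, Set.mem_ofPred_eq, ← coe_toReal_of_mem_effDom hf.1 hp]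
        by_cases hq : q ∈ effDom (conj f)
        · rw [← coe_toReal_of_mem_effDom (conj_ne_bot hf) hq, ← EReal.coe_add,
            EReal.coe_eq_coe_iff, EReal.coe_eq_coe_iff, eq_sub_iff_add_eq, EReal.toReal_coe]
        · rw [eq_top_of_notMem_effDom hq, EReal.top_add_coe]
          simp only [(EReal.coe_ne_top _).symm]
      _ ↔ conj f q ≤ ((q ⬝ᵥ p - (f p).toReal : ℝ) : EReal) := by
        refine ⟨le_of_eq, fun h => h.antisymm ?_⟩
        rw [EReal.coe_sub, coe_toReal_of_mem_effDom hf.1 hp]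
        exact le_iSup (fun v => ((q ⬝ᵥ v : ℝ) : EReal) - f v) p
      _ ↔ ∀ v ∈ effDom f, (f p).toReal + q ⬝ᵥ (v - p) ≤ (f v).toReal := by
        rw [conj_le_coe_iff hf.1]
        refine forall₂_congr fun v _ => ?_
        rw [dotProduct_sub]
        constructor <;> intro h <;> linarith
      _ ↔ _ := by simp only [hp, true_and]
  · simp [subdiff, hp, eq_top_of_notMem_effDom hp, EReal.add_top_of_ne_bot (conj_ne_bot hf q)]

end Conjugate

section BoxMinimisation

variable {ι : Type*} [Fintype ι] {f : (ι → ℝ) → EReal} {p u : ι → ℝ}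

/-- Kuhn–Tucker conditions for a box: `q` is `-b` corrected by the multipliers of the bounds
`v ≤ w` (which lower it) and `u ≤ v` (which raise it, but vanish where `u i < z i`). -/
lemma exists_mem_subdiff_of_isMinOn_box (hf : IsProper f) (hconv : IsConvex f)
    {w b z : ι → ℝ} (hp : p ∈ relCore (effDom f)) (hpK : p ∈ Set.Icc u w)
    (hz : z ∈ effDom f ∩ Set.Icc u w)
    (hmin : IsMinOn (fun v => (f v).toReal + b ⬝ᵥ v) (effDom f ∩ Set.Icc u w) z) :
    ∃ q ∈ subdiff f z, ∀ i, u i < z i → q i ≤ -b i := by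
  let coord (i : ι) : (ι → ℝ) →ᵃ[ℝ] ℝ := (LinearMap.proj (R := ℝ) i).toAffineMap
  let a : ι ⊕ ι → (ι → ℝ) →ᵃ[ℝ] ℝ := Sum.elim
    (fun i => coord i - const ℝ _ (w i)) (fun i => const ℝ _ (u i) - coord i)
  have hal (i v) : a (.inl i) v = v i - w i := rfl
  have har (i v) : a (.inr i) v = u i - v i := rfl
  have hbox : effDom f ∩ Set.Icc u w = {v ∈ effDom f | ∀ j ∈ Finset.univ, a j v ≤ 0} := by
    ext v
    simp only [Set.mem_inter_iff, Set.mem_sep_iff, Set.mem_Icc, Finset.mem_univ, true_imp_iff,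
      Sum.forall, hal, har, sub_nonpos, Pi.le_def, and_comm]
  have hconvex : ConvexOn ℝ (effDom f) fun v => (f v).toReal + b ⬝ᵥ v :=
    (hconv.convexOn_toReal hf.1).add
      ((dotProductBilin ℝ ℝ b).convexOn (hconv.convexOn_toReal hf.1).1)
  rw [hbox] at hz hmin
  obtain ⟨l, hl, hslack, hlag⟩ := exists_multipliers_of_isMinOn hp hconvex Finset.univ a
    (hbox.subset ⟨hp.1, hpK⟩).2 hz hmin
  let l₁ (i : ι) := l (.inl i)
  let l₂ (i : ι) := l (.inr i)
  refine ⟨-b - l₁ + l₂, (mem_subdiff_iff hf).2 ⟨hz.1, fun v hv => ?_⟩, fun i hi => ?_⟩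
  · have hsum : ∑ j, l j * a j v = (l₁ - l₂) ⬝ᵥ (v - z) := by
      rw [← sub_zero (∑ j, _), ← Finset.sum_eq_zero hslack, ← Finset.sum_sub_distrib,
        Fintype.sum_sum_type, ← Finset.sum_add_distrib, dotProduct]
      refine Finset.sum_congr rfl fun i _ => ?_
      simp only [hal, har, Pi.sub_apply, l₁, l₂]
      ring
    have hv := hlag v hv
    rw [hsum] at hv
    simp only [dotProduct_sub, add_dotProduct, sub_dotProduct, neg_dotProduct] at hv ⊢
    linarith
  · have hl₂ : l₂ i = 0 := (mul_eq_zero.1 (hslack (.inr i) (Finset.mem_univ _))).resolve_right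
      (by rw [har]; linarith)
    have hl₁ : 0 ≤ l₁ i := hl (.inl i)
    simp only [Pi.add_apply, Pi.sub_apply, Pi.neg_apply, hl₂]
    linarith

lemma subdiff_nonempty_of_mem_relCore (hf : IsProper f) (hconv : IsConvex f)
    (hp : p ∈ relCore (effDom f)) : (subdiff f p).Nonempty := by
  obtain ⟨q, hq, -⟩ := exists_mem_subdiff_of_isMinOn_box (u := p) (w := p) (b := 0) (z := p) hf
    hconv hp ⟨le_rfl, le_rfl⟩ ⟨hp.1, le_rfl, le_rfl⟩ fun v hv => by
      rw [Set.Icc_self] at hv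
      rw [hv.2, Set.mem_ofPred_eq]
  exact ⟨q, hq⟩

/-- The penalised problems force their solutions to `u` as the penalty factor `k` grows. -/
lemma le_coe_of_forall_exists_penalty {X : Type*} [TopologicalSpace X] [T2Space X]
    {F : X → EReal} (hF : LowerSemicontinuous F) (hbot : ∀ v, F v ≠ ⊥) {K : Set X}
    (hK : IsCompact K) {g : X → ℝ} (hg : Continuous g) (hg₀ : ∀ v ∈ K, 0 ≤ g v) {u : X}
    (hgu : ∀ v ∈ K, g v ≤ 0 → v = u) {r : ℝ}
    (h : ∀ k : ℕ, ∃ v ∈ K, F v ≤ ((r - k * g v : ℝ) : EReal)) : F u ≤ r := by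
  let T (k : ℕ) : Set X := K ∩ {v | F v ≤ ((r - k * g v : ℝ) : EReal)}
  have hclosed (k : ℕ) : IsClosed {v | F v ≤ ((r - k * g v : ℝ) : EReal)} :=
    hF.isClosed_epigraph.preimage (continuous_id.prodMk
      (continuous_coe_real_ereal.comp (continuous_const.sub (continuous_const.mul hg))))
  have hT (k : ℕ) : IsCompact (T k) := hK.inter_right (hclosed k)
  obtain ⟨a, ha⟩ := IsCompact.nonempty_iInter_of_sequence_nonempty_isCompact_isClosed T
    (fun k v hv => ⟨hv.1, hv.2.trans (EReal.coe_le_coe_iff.2 (by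
      push_cast
      linarith [hg₀ v hv.1]))⟩)
    h (hT 0) fun k => (hT k).isClosed
  rw [Set.mem_iInter] at ha
  have hga : g a ≤ 0 := by
    by_contra! hpos
    obtain ⟨k, hk⟩ := exists_nat_gt ((r - (F a).toReal) / g a)
    rw [div_lt_iff₀ hpos] at hk
    have hFa : (F a).toReal ≤ r - k * g a := by
      rw [← EReal.toReal_coe (r - k * g a)]
      exact EReal.toReal_le_toReal (ha k).2 (hbot a) (EReal.coe_ne_top _)
    linarith
  rw [← hgu a (ha 0).1 hga]
  simpa using (ha 0).2

end BoxMinimisation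

section SubdiffExchange

variable {ι : Type*}

lemma SetQLE.exists_between {I : Set ι} {X Y : Set (ι → ℝ)} (h : SetQLE (proj I X) (proj I Y))
    {x y : ι → ℝ} (hx : x ∈ X) (hy : y ∈ Y) (S : Set ι) :
    ∃ y' ∈ Y, ∀ i ∈ I, (i ∈ S → x i ≤ y' i) ∧ (i ∉ S → y' i ≤ y i) := by
  classical
  obtain ⟨δ₂, hδ₂, -, y', hy', hyδ⟩ := h _ ⟨x, hx, rfl⟩ _ ⟨y, hy, rfl⟩
    (fun i => if (i : ι) ∈ S then (x i - y i)⁺ else 0)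
    ⟨fun i => by simp only [Pi.zero_apply]; positivity, fun i => by
      simp only [Pi.posPart_apply, Pi.sub_apply]
      split_ifs
      exacts [le_rfl, posPart_nonneg _]⟩
  refine ⟨y', hy', fun i hi => ?_⟩
  have hyi : y' i = y i + ((if i ∈ S then (x i - y i)⁺ else 0) - δ₂ ⟨i, hi⟩) :=
    congrFun hyδ ⟨i, hi⟩
  have hδ₂i : 0 ≤ δ₂ ⟨i, hi⟩ ∧ δ₂ ⟨i, hi⟩ ≤ (x i - y i)⁻ := ⟨hδ₂.1 ⟨i, hi⟩, hδ₂.2 ⟨i, hi⟩⟩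
  refine ⟨fun hS => ?_, fun hS => ?_⟩
  · rw [if_pos hS] at hyi
    linarith [posPart_sub_negPart (x i - y i)]
  · rw [if_neg hS] at hyi
    linarith

lemma SetQLE.neg {X Y : Set (ι → ℝ)} (h : SetQLE X Y) : SetQLE (-Y) (-X) := by
  intro y hy x hx δ₁ hδ₁
  obtain ⟨δ₂, hδ₂, hxδ, hyδ⟩ := h (-x) hx (-y) hy δ₁ (by rwa [neg_sub_neg])
  refine ⟨δ₂, by rwa [neg_sub_neg] at hδ₂, ?_, ?_⟩
  · rwa [Set.mem_neg, neg_sub', sub_neg_eq_add]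
  · rwa [Set.mem_neg, neg_add']

lemma proj_neg (I : Set ι) (X : Set (ι → ℝ)) : proj I (-X) = -proj I X := by
  ext z
  constructor
  · rintro ⟨x, hx, rfl⟩
    exact ⟨-x, hx, rfl⟩
  · rintro ⟨x, hx, hxz⟩
    exact ⟨-x, by simpa using hx, by rw [← neg_eq_iff_eq_neg.2 hxz]; rfl⟩

lemma IsProper.comp_neg {f : (ι → ℝ) → EReal} (hf : IsProper f) : IsProper fun v => f (-v) :=
  ⟨fun v => hf.1 (-v), hf.2.neg⟩

lemma IsConvex.comp_neg {f : (ι → ℝ) → EReal} (hf : IsConvex f) : IsConvex fun v => f (-v) :=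
  hf.linear_preimage ((-LinearMap.id).prodMap LinearMap.id)

lemma inf_eq_zero_iff_forall {d w : ι → ℝ} :
    d ⊓ w = 0 ↔ ∀ i, (d i = 0 ∧ 0 ≤ w i) ∨ (w i = 0 ∧ 0 ≤ d i) := by
  simp only [funext_iff, Pi.inf_apply, Pi.zero_apply, min_eq_iff]
  refine forall_congr' fun i => or_congr ?_ ?_ <;>
    exact and_congr_right fun h => by rw [h]

lemma smul_inf_eq_zero {d w : ι → ℝ} (hdw : d ⊓ w = 0) {s : ℝ} (hs : 0 ≤ s) :
    s • d ⊓ w = 0 :=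
  inf_eq_zero_iff_forall.2 fun i => (inf_eq_zero_iff_forall.1 hdw i).imp
    (fun h => ⟨by simp [h.1], h.2⟩) (fun h => ⟨h.1, mul_nonneg hs h.2⟩)

variable [Fintype ι] {f : (ι → ℝ) → EReal} {p x d w : ι → ℝ}

/-- Subgradients of `f` at comparable points can be exchanged on the coordinates where the points
agree. For `f = c*` this is the third assertion of the theorem. -/
def SubdiffExchangeable (f : (ι → ℝ) → EReal) : Prop :=
  ∀ p p' : ι → ℝ, p ≤ p' →
    SetQLE (proj (agree p p') (subdiff f p')) (proj (agree p p') (subdiff f p))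

lemma conj_comp_neg (f : (ι → ℝ) → EReal) (p : ι → ℝ) :
    conj (fun v => f (-v)) p = conj f (-p) :=
  (Equiv.neg _).iSup_congr fun q => by simp

lemma subdiff_comp_neg (f : (ι → ℝ) → EReal) (p : ι → ℝ) :
    subdiff (fun v => f (-v)) p = -subdiff f (-p) := by
  ext x
  simp [subdiff, conj_comp_neg]

lemma SubdiffExchangeable.comp_neg (h : SubdiffExchangeable f) :
    SubdiffExchangeable fun v => f (-v) := by
  intro p p' hpp'
  have hagree : agree (-p') (-p) = agree p p' := by
    ext i
    simp [agree, eq_comm]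
  have hneg := (h _ _ (neg_le_neg hpp')).neg
  rw [hagree] at hneg
  simpa only [subdiff_comp_neg, proj_neg] using hneg

lemma SubdiffExchangeable.exists_mem_subdiff (h : SubdiffExchangeable f) {z q : ι → ℝ}
    (hzp : z ≤ p) (hx : x ∈ subdiff f p) (hq : q ∈ subdiff f z) (S : Set ι) :
    ∃ q' ∈ subdiff f z, ∀ i, (i ∈ S → z i = p i → x i ≤ q' i) ∧ (i ∉ S → q' i ≤ q i) := by
  obtain ⟨y, hy, hxy⟩ := (h z p hzp).exists_between hx hq Set.univ
  obtain ⟨q', hq', hyq⟩ := (h z z le_rfl).exists_between hy hq S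
  exact ⟨q', hq', fun i => ⟨fun hi hzpi => ((hxy i hzpi).1 trivial).trans ((hyq i rfl).1 hi),
    (hyq i rfl).2⟩⟩

lemma SubdiffExchangeable.exists_mem_Icc_le (h : SubdiffExchangeable f) (hf : IsProper f)
    (hconv : IsConvex f) (hlsc : LowerSemicontinuous f) (hp : p ∈ relCore (effDom f))
    (hx : x ∈ subdiff f p) (hdw : d ⊓ w = 0) (hmem : p + d - w ∈ effDom f) (k : ℝ) :
    ∃ z ∈ Set.Icc (p - w) p,
      f z ≤ (((f (p + d - w)).toReal - x ⬝ᵥ d - k * ∑ i, (z - (p - w)) i : ℝ) : EReal) := by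
  have hcases := inf_eq_zero_iff_forall.1 hdw
  have hw : 0 ≤ w := fun i => (hcases i).elim (·.2) (·.1.ge)
  have hpbox : p ∈ Set.Icc (p - w) p := ⟨sub_le_self p hw, le_rfl⟩
  obtain ⟨z, hz, hmin⟩ := exists_isMinOn_toReal_add hf.1 hlsc (isCompact_Icc (a := p - w))
    ⟨p, hp.1, hpbox⟩ (g := fun v => (fun _ => k) ⬝ᵥ v) (by simp only [dotProduct]; fun_prop)
  obtain ⟨q, hq, hqk⟩ := exists_mem_subdiff_of_isMinOn_box hf hconv hp hpbox hz hmin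
  obtain ⟨q', hq', hxqq'⟩ := h.exists_mem_subdiff hz.2.2 hx hq {i | w i = 0}
  refine ⟨z, hz.2, (le_coe_iff hf.1).2 ⟨hz.1, ?_⟩⟩
  have hcoord (i) : x i * d i + k * (z - (p - w)) i ≤ q' i * (p + d - w - z) i := by
    have hzi : p i - w i ≤ z i ∧ z i ≤ p i := ⟨hz.2.1 i, hz.2.2 i⟩
    simp only [Pi.add_apply, Pi.sub_apply]
    by_cases hwi : w i = 0
    · have hdi : 0 ≤ d i := (hcases i).elim (·.1.ge) (·.2)
      have hzpi : z i = p i := by linarith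
      rw [hzpi, hwi]
      linarith [mul_le_mul_of_nonneg_right ((hxqq' i).1 hwi hzpi) hdi]
    · have hdi : d i = 0 := (hcases i).elim (·.1) fun h => absurd h.1 hwi
      have hqi : q' i ≤ q i := (hxqq' i).2 hwi
      rcases hzi.1.lt_or_eq with hlt | heq
      · have hqki : q i ≤ -k := hqk i hlt
        rw [hdi]
        nlinarith
      · rw [hdi, ← heq]
        linarith
  have hsum : x ⬝ᵥ d + k * ∑ i, (z - (p - w)) i ≤ q' ⬝ᵥ (p + d - w - z) := by
    rw [Finset.mul_sum, dotProduct, ← Finset.sum_add_distrib]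
    exact Finset.sum_le_sum fun i _ => hcoord i
  linarith [((mem_subdiff_iff hf).1 hq').2 _ hmem]

lemma SubdiffExchangeable.apply_sub_le (h : SubdiffExchangeable f) (hf : IsProper f)
    (hconv : IsConvex f) (hlsc : LowerSemicontinuous f) (hp : p ∈ relCore (effDom f))
    (hx : x ∈ subdiff f p) (hdw : d ⊓ w = 0) (hmem : p + d - w ∈ effDom f) :
    f (p - w) ≤ (((f (p + d - w)).toReal - x ⬝ᵥ d : ℝ) : EReal) := by
  refine le_coe_of_forall_exists_penalty hlsc hf.1 (isCompact_Icc (a := p - w) (b := p))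
    (g := fun v => ∑ i, (v - (p - w)) i) (by simp only [Pi.sub_apply]; fun_prop)
    (fun v hv => Finset.sum_nonneg fun i _ => (sub_nonneg.2 hv.1) i) (fun v hv hle => ?_)
    fun k => h.exists_mem_Icc_le hf hconv hlsc hp hx hdw hmem k
  have hnonneg : 0 ≤ v - (p - w) := sub_nonneg.2 hv.1
  have hzero := hle.antisymm (Finset.sum_nonneg fun i _ => hnonneg i)
  exact sub_eq_zero.1 ((Fintype.sum_eq_zero_iff_of_nonneg hnonneg).1 hzero)

lemma SubdiffExchangeable.sub_mem_effDom (h : SubdiffExchangeable f) (hf : IsProper f)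
    (hconv : IsConvex f) (hlsc : LowerSemicontinuous f) (hp : p ∈ relCore (effDom f))
    (hdw : d ⊓ w = 0) (hmem : p + d - w ∈ effDom f) : p - w ∈ effDom f := by
  obtain ⟨x, hx⟩ := subdiff_nonempty_of_mem_relCore hf hconv hp
  exact ((le_coe_iff hf.1).1 (h.apply_sub_le hf hconv hlsc hp hx hdw hmem)).1

lemma SubdiffExchangeable.add_mem_effDom (h : SubdiffExchangeable f) (hf : IsProper f)
    (hconv : IsConvex f) (hlsc : LowerSemicontinuous f) (hp : p ∈ relCore (effDom f))
    (hdw : d ⊓ w = 0) (hmem : p + d - w ∈ effDom f) : p + d ∈ effDom f := by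
  have hneg : -p ∈ relCore (effDom fun v => f (-v)) :=
    relCore_neg (C := effDom f) ▸ Set.neg_mem_neg.2 hp
  have hneg' : -p + w - d ∈ effDom fun v => f (-v) := by
    have : -(-p + w - d) = p + d - w := by abel
    rwa [← this] at hmem
  have hmem' : -p - d ∈ -effDom f := h.comp_neg.sub_mem_effDom hf.comp_neg hconv.comp_neg
    (hlsc.comp continuous_neg) hneg (inf_comm w d ▸ hdw) hneg'
  rwa [← neg_add', Set.neg_mem_neg] at hmem'

/-- A subgradient at `p` bounds the left-hand side of `f (p - w) - f (p + d - w) ≤ f (p - d) - f p`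
by exchange and the right-hand side by convexity. -/
lemma SubdiffExchangeable.add_le_add_sub (h : SubdiffExchangeable f) (hf : IsProper f)
    (hconv : IsConvex f) (hlsc : LowerSemicontinuous f) (hp : p ∈ relCore (effDom f))
    (hdw : d ⊓ w = 0) : f (p - w) + f p ≤ f (p + d - w) + f (p - d) := by
  refine (add_le_add_iff_toReal hf.1).2 fun hup hdown => ?_
  obtain ⟨x, hx⟩ := subdiff_nonempty_of_mem_relCore hf hconv hp
  have hexchange := (le_coe_iff hf.1).1 (h.apply_sub_le hf hconv hlsc hp hx hdw hup)
  have hsubgrad := ((mem_subdiff_iff hf).1 hx).2 _ hdown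
  rw [sub_sub_cancel_left, dotProduct_neg] at hsubgrad
  exact ⟨hexchange.1, hp.1, by linarith [hexchange.2]⟩

lemma SubdiffExchangeable.add_le_add_nsmul (h : SubdiffExchangeable f) (hf : IsProper f)
    (hconv : IsConvex f) (hlsc : LowerSemicontinuous f) (hdw : d ⊓ w = 0) {N : ℕ}
    (hp : ∀ k ≤ N, p + k • d ∈ relCore (effDom f)) :
    f (p + d - w) + f (p + N • d) ≤ f (p + (N + 1) • d - w) + f p := by
  induction N with
  | zero => simp
  | succ N ih =>
    refine (add_le_add_iff_toReal hf.1).2 fun hup hp₀ => ?_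
    have hlast := h.add_le_add_sub hf hconv hlsc (hp (N + 1) le_rfl) hdw
    rw [show p + (N + 1) • d + d = p + (N + 1 + 1) • d by module,
      show p + (N + 1) • d - d = p + N • d by module] at hlast
    obtain ⟨hmid, hpN, hlast⟩ := (add_le_add_iff_toReal hf.1).1 hlast hup
      (hp N (Nat.le_succ N)).1
    obtain ⟨hpw, -, hih⟩ := (add_le_add_iff_toReal hf.1).1
      (ih fun k hk => hp k (hk.trans (Nat.le_succ N))) hmid hp₀
    exact ⟨hpw, hpN, by linarith⟩

lemma SubdiffExchangeable.add_le_add_of_mem_relCore (h : SubdiffExchangeable f)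
    (hf : IsProper f) (hconv : IsConvex f) (hlsc : LowerSemicontinuous f)
    (hp : p ∈ relCore (effDom f)) (hdw : d ⊓ w = 0) :
    f (p - w) + f (p + d) ≤ f (p + d - w) + f p := by
  refine (add_le_add_iff_toReal hf.1).2 fun hup _ => (add_le_coe_iff hf.1).1 ?_
  have hpd := h.add_mem_effDom hf hconv hlsc hp hdw hup
  have hstep (N : ℕ) : f (p + (1 / (N + 1) : ℝ) • d - w) + f (p + (1 - 1 / (N + 1) : ℝ) • d)
      ≤ (((f (p + d - w)).toReal + (f p).toReal : ℝ) : EReal) := by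
    have hrel (k : ℕ) (hk : k ≤ N) : p + k • (1 / (N + 1) : ℝ) • d ∈ relCore (effDom f) := by
      have hk' : (k : ℝ) ≤ N := Nat.cast_le.2 hk
      convert lineMap_mem_relCore (hconv.convexOn_toReal hf.1).1 hp hpd (t := k / (N + 1))
        ⟨by positivity, by rw [div_lt_one (by positivity)]; linarith⟩ using 1
      rw [lineMap_apply_module]
      module
    have hN := h.add_le_add_nsmul hf hconv hlsc
      (smul_inf_eq_zero hdw (by positivity : (0 : ℝ) ≤ 1 / (N + 1))) hrel
    rw [show N • (1 / (N + 1) : ℝ) • d = (1 - 1 / (N + 1) : ℝ) • d by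
        match_scalars; field_simp; ring,
      show (N + 1) • (1 / (N + 1) : ℝ) • d = d by match_scalars; field_simp] at hN
    exact (add_le_coe_iff hf.1).2 ((add_le_add_iff_toReal hf.1).1 hN hup hp.1)
  have hlim := tendsto_one_div_add_atTop_nhds_zero_nat (𝕜 := ℝ)
  have hcont : Continuous fun s : ℝ => (p + s • d - w, p + (1 - s) • d) := by fun_prop
  simpa using le_coe_of_tendsto_of_lowerSemicontinuous (lowerSemicontinuous_add_prod hf.1 hlsc)
    ((hcont.tendsto 0).comp hlim) tendsto_const_nhds (Eventually.of_forall hstep)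

theorem SubdiffExchangeable.isSubmodular (h : SubdiffExchangeable f) (hf : IsProper f)
    (hconv : IsConvex f) (hlsc : LowerSemicontinuous f) : IsSubmodular f := by
  refine (isSubmodular_iff hf.1).2 fun p hp p' hp' => (add_le_coe_iff hf.1).1 ?_
  have hconv' := hconv.convexOn_toReal hf.1
  obtain ⟨o, ho⟩ := relCore_nonempty hconv'.1 hf.2
  have hstep (t : ℝ) (ht : t ∈ Set.Ico 0 1) : f (lineMap o p t ⊓ p') + f (lineMap o p t ⊔ p')
      ≤ ((lineMap (f o).toReal (f p).toReal t + (f p').toReal : ℝ) : EReal) := by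
    have hq := lineMap_mem_relCore hconv'.1 ho hp ht
    have hfq : (f (lineMap o p t)).toReal ≤ lineMap (f o).toReal (f p).toReal t := by
      simpa only [lineMap_apply_module] using
        hconv'.2 ho.1 hp (sub_nonneg.2 ht.2.le) ht.1 (sub_add_cancel 1 t)
    set q := lineMap o p t
    have hdiff := posPart_sub_negPart (p' - q)
    have hinf : q - (p' - q)⁻ = q ⊓ p' := by
      rw [inf_eq_sub_posPart_sub, ← negPart_neg, neg_sub]
    have hsup : q + (p' - q)⁺ = q ⊔ p' := by rw [sup_comm, sup_eq_add_posPart_sub]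
    have hsub := h.add_le_add_of_mem_relCore hf hconv hlsc hq
      (posPart_inf_negPart_eq_zero (p' - q))
    rw [add_sub_assoc, hdiff, add_sub_cancel, hinf, hsup] at hsub
    obtain ⟨hmin, hmax, hle⟩ := (add_le_add_iff_toReal hf.1).1 hsub hp' hq.1
    exact (add_le_coe_iff hf.1).2 ⟨hmin, hmax, by linarith⟩
  have hpath : Continuous fun t : ℝ => (lineMap o p t ⊓ p', lineMap o p t ⊔ p') :=
    have hcoord (i : ι) : Continuous fun t : ℝ => lineMap o p t i :=
      (continuous_apply i).comp lineMap_continuous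
    (continuous_pi fun i => (hcoord i).inf continuous_const).prodMk
      (continuous_pi fun i => (hcoord i).sup continuous_const)
  have hvalue : Continuous fun t : ℝ =>
    lineMap (f o).toReal (f p).toReal t + (f p').toReal := lineMap_continuous.add_const _
  have hmem : ∀ᶠ t in 𝓝[<] (1 : ℝ), t ∈ Set.Ico (0 : ℝ) 1 :=
    Ico_mem_nhdsLT zero_lt_one
  simpa using le_coe_of_tendsto_of_lowerSemicontinuous (lowerSemicontinuous_add_prod hf.1 hlsc)
    ((hpath.tendsto 1).mono_left nhdsWithin_le_nhds)
    ((hvalue.tendsto 1).mono_left nhdsWithin_le_nhds) (hmem.mono hstep)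

end SubdiffExchange

section Separation

variable {V : Type*} [TopologicalSpace V] [AddCommGroup V] [Module ℝ V] {F : V → EReal}

lemma exists_clm_sub_of_pos [ContinuousConstSMul ℝ V] [IsTopologicalAddGroup V] (l : V →L[ℝ] ℝ)
    {τ : ℝ} (hτ : 0 < τ) (v : ℝ) :
    ∃ (l' : V →L[ℝ] ℝ) (b : ℝ), ∀ a r, r < l' a - b ↔ l a + τ * r < v := by
  refine ⟨-(τ⁻¹ • l), -(τ⁻¹ * v), fun a r => ?_⟩
  have h : (-(τ⁻¹ • l)) a - -(τ⁻¹ * v) = (v - l a) / τ := by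
    rw [neg_apply, smul_apply, smul_eq_mul]
    ring
  rw [h, lt_div_iff₀' hτ, lt_sub_iff_add_lt']

variable [IsTopologicalAddGroup V] [ContinuousSMul ℝ V] [LocallyConvexSpace ℝ V]

lemma exists_separation_epigraph (hF : Convex ℝ {z : V × ℝ | F z.1 ≤ z.2})
    (hlsc : LowerSemicontinuous F) (hdom : ∃ a, F a < ⊤) {K : Set V} (hK : IsCompact K)
    (hKc : Convex ℝ K) {M : ℝ} (hMK : ∀ k ∈ K, M < F k) :
    ∃ (l : V →L[ℝ] ℝ) (τ v : ℝ), 0 ≤ τ ∧ (∃ u < v, ∀ k ∈ K, l k + τ * M < u) ∧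
      ∀ a (r : ℝ), F a ≤ r → v < l a + τ * r := by
  have hclosed : IsClosed {z : V × ℝ | F z.1 ≤ z.2} :=
    hlsc.isClosed_epigraph.preimage
      (continuous_fst.prodMk (continuous_coe_real_ereal.comp continuous_snd))
  have hdisj : Disjoint (K ×ˢ {M}) {z : V × ℝ | F z.1 ≤ z.2} := by
    rw [Set.disjoint_left]
    rintro ⟨k, _⟩ ⟨hk, rfl⟩
    exact (hMK k hk).not_ge
  obtain ⟨L, u, v, hLK, huv, hLF⟩ := geometric_hahn_banach_compact_closed
    (hKc.prod (convex_singleton M)) (hK.prod isCompact_singleton) hF hclosed hdisj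
  have hL (a r) : L (a, r) = L.comp (.inl ℝ V ℝ) a + L (0, 1) * r := by
    have : ((a, r) : V × ℝ) = (a, 0) + r • (0, 1) := by simp
    rw [this, map_add, map_smul, smul_eq_mul, mul_comm]
    rfl
  refine ⟨L.comp (.inl ℝ V ℝ), L (0, 1), v, ?_, ⟨u, huv, fun k hk => ?_⟩, fun a r har => ?_⟩
  · by_contra! hneg
    obtain ⟨a, ha⟩ := hdom
    obtain ⟨r, har, -⟩ := EReal.lt_iff_exists_real_btwn.1 ha
    set t := max r ((v - L.comp (.inl ℝ V ℝ) a) / L (0, 1))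
    have hat : v < L (a, t) :=
      hLF _ (har.le.trans (EReal.coe_le_coe_iff.2 (le_max_left _ _)))
    have ht : t * L (0, 1) ≤ v - L.comp (.inl ℝ V ℝ) a :=
      (div_le_iff_of_neg hneg).1 (le_max_right _ _)
    rw [hL] at hat
    linarith
  · rw [← hL]
    exact hLK _ ⟨hk, rfl⟩
  · rw [← hL]
    exact hLF _ har

lemma exists_affine_minorant (hF : Convex ℝ {z : V × ℝ | F z.1 ≤ z.2})
    (hlsc : LowerSemicontinuous F) {x : V} (hbot : F x ≠ ⊥) (htop : F x ≠ ⊤) :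
    ∃ (l : V →L[ℝ] ℝ) (b : ℝ), ∀ a (r : ℝ), F a ≤ r → l a - b ≤ r := by
  have hx : ((F x).toReal : EReal) = F x := EReal.coe_toReal htop hbot
  obtain ⟨l, τ, v, -, ⟨u, huv, hK⟩, hle⟩ := exists_separation_epigraph hF hlsc
    ⟨x, htop.lt_top⟩ isCompact_singleton (convex_singleton x) (M := (F x).toReal - 1) (by
      rintro _ rfl
      rw [← hx, EReal.coe_lt_coe_iff, EReal.toReal_coe]
      exact sub_one_lt _)
  have hlt := hK x rfl
  have hgt := hle x _ hx.ge
  have hpos : 0 < τ := by linarith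
  obtain ⟨l', b, h⟩ := exists_clm_sub_of_pos l hpos v
  exact ⟨l', b, fun a r har => not_lt.1 fun hr => ((h a r).1 hr).not_gt (hle a r har)⟩

lemma exists_affine_minorant_gt (hF : Convex ℝ {z : V × ℝ | F z.1 ≤ z.2})
    (hlsc : LowerSemicontinuous F) {x : V} (hbot : F x ≠ ⊥) (htop : F x ≠ ⊤) {K : Set V}
    (hK : IsCompact K) (hKc : Convex ℝ K) {M : ℝ} (hMK : ∀ k ∈ K, M < F k) :
    ∃ (l : V →L[ℝ] ℝ) (b : ℝ), (∀ a (r : ℝ), F a ≤ r → l a - b ≤ r) ∧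
      ∀ k ∈ K, M < l k - b := by
  obtain ⟨l, τ, v, hτ, ⟨u, huv, hlK⟩, hle⟩ :=
    exists_separation_epigraph hF hlsc ⟨x, htop.lt_top⟩ hK hKc hMK
  rcases hτ.lt_or_eq with hpos | rfl
  · obtain ⟨l', b, h⟩ := exists_clm_sub_of_pos l hpos v
    exact ⟨l', b, fun a r har => not_lt.1 fun hr => ((h a r).1 hr).not_gt (hle a r har),
      fun k hk => (h k M).2 ((hlK k hk).trans huv)⟩
  -- The hyperplane is vertical: tilt an arbitrary affine minorant by a large multiple of it.
  · obtain ⟨l₀, b₀, h₀⟩ := exists_affine_minorant hF hlsc hbot htop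
    obtain ⟨B, hB⟩ := (hK.image l₀.continuous).bddBelow
    obtain ⟨N, hN⟩ := exists_nat_gt ((M + b₀ - B) / (v - u))
    rw [div_lt_iff₀ (sub_pos.2 huv)] at hN
    simp only [zero_mul, add_zero] at hlK hle
    refine ⟨l₀ - (N : ℝ) • l, b₀ - N * v, fun a r har => ?_, fun k hk => ?_⟩
    · have hNa := mul_le_mul_of_nonneg_left (hle a r har).le N.cast_nonneg
      have h₀a := h₀ a r har
      simp only [_root_.sub_apply, _root_.smul_apply, smul_eq_mul]
      linarith
    · have hNk := mul_le_mul_of_nonneg_left (hlK k hk).le N.cast_nonneg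
      have hBk : B ≤ l₀ k := hB ⟨k, hk, rfl⟩
      simp only [_root_.sub_apply, _root_.smul_apply, smul_eq_mul]
      linarith

end Separation

section Biconjugate

variable {ι : Type*} [Fintype ι] {f : (ι → ℝ) → EReal} {p q : ι → ℝ}

lemma exists_dotProduct_eq (l : (ι → ℝ) →L[ℝ] ℝ) : ∃ p : ι → ℝ, ∀ x, l x = p ⬝ᵥ x := by
  classical
  obtain ⟨p, hp⟩ := (dotProductEquiv ℝ ι).surjective l.toLinearMap
  exact ⟨p, fun x => (LinearMap.congr_fun hp x).symm⟩

lemma conj_isConvex (hbot : ∀ x, f x ≠ ⊥) : IsConvex (conj f) := by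
  have : {z : (ι → ℝ) × ℝ | conj f z.1 ≤ z.2} =
      ⋂ q ∈ effDom f, {z | z.1 ⬝ᵥ q - z.2 ≤ (f q).toReal} := by
    ext z
    simp only [Set.mem_iInter, Set.mem_ofPred_eq, conj_le_coe_iff hbot, sub_le_comm]
  rw [IsConvex, this]
  refine convex_iInter₂ fun q _ => convex_halfSpace_le ⟨fun z w => ?_, fun s z => ?_⟩ _
  · simp only [Prod.fst_add, Prod.snd_add, add_dotProduct]
    ring
  · simp only [Prod.smul_fst, Prod.smul_snd, smul_dotProduct, smul_eq_mul, mul_sub]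

lemma conj_lowerSemicontinuous (hbot : ∀ x, f x ≠ ⊥) : LowerSemicontinuous (conj f) := by
  refine lowerSemicontinuous_iSup fun q => ?_
  by_cases hq : q ∈ effDom f
  · rw [← coe_toReal_of_mem_effDom hbot hq]
    refine (continuous_coe_real_ereal.comp (f := fun p => p ⬝ᵥ q - (f q).toReal)
      ?_).lowerSemicontinuous
    fun_prop
  · simp only [eq_top_of_notMem_effDom hq, EReal.sub_top]
    exact lowerSemicontinuous_const

lemma conj_isProper (hf : IsProper f) (hconv : IsConvex f) (hlsc : LowerSemicontinuous f) :
    IsProper (conj f) := by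
  obtain ⟨x, hx⟩ := hf.2
  obtain ⟨l, b, hle⟩ := exists_affine_minorant hconv hlsc (hf.1 x) hx.ne
  obtain ⟨p, hp⟩ := exists_dotProduct_eq l
  refine ⟨conj_ne_bot hf, p,
    ((conj_le_coe_iff hf.1 (r := b)).2 fun q hq => ?_).trans_lt (EReal.coe_lt_top b)⟩
  rw [sub_le_comm, ← hp]
  exact hle q _ (coe_toReal_of_mem_effDom hf.1 hq).ge

theorem conj_conj (hf : IsProper f) (hconv : IsConvex f) (hlsc : LowerSemicontinuous f) :
    conj (conj f) = f := by
  funext q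
  refine le_antisymm (iSup_le fun p => ?_) (EReal.ge_of_forall_gt_iff_ge.1 fun M hM => ?_)
  · rw [EReal.sub_le_iff_le_add (Or.inl (conj_ne_bot hf p)) (Or.inr (hf.1 q)), add_comm,
      ← EReal.sub_le_iff_le_add (Or.inl (hf.1 q)) (Or.inr (conj_ne_bot hf p)), dotProduct_comm]
    exact le_iSup (fun v => ((p ⬝ᵥ v : ℝ) : EReal) - f v) q
  · obtain ⟨x, hx⟩ := hf.2
    obtain ⟨l, b, hle, hlt⟩ := exists_affine_minorant_gt hconv hlsc (hf.1 x) hx.ne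
      isCompact_singleton (convex_singleton q) (by rintro _ rfl; exact hM)
    obtain ⟨p, hp⟩ := exists_dotProduct_eq l
    have hpb : conj f p ≤ b := (conj_le_coe_iff hf.1).2 fun v hv => by
      rw [sub_le_comm, ← hp]
      exact hle v _ (coe_toReal_of_mem_effDom hf.1 hv).ge
    calc (M : EReal)
      _ ≤ ((q ⬝ᵥ p : ℝ) : EReal) - b := by
        rw [dotProduct_comm, ← hp, ← EReal.coe_sub, EReal.coe_le_coe_iff]
        exact (hlt q rfl).le
      _ ≤ ((q ⬝ᵥ p : ℝ) : EReal) - conj f p := EReal.sub_le_sub le_rfl hpb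
      _ ≤ conj (conj f) q := le_iSup (fun p => ((q ⬝ᵥ p : ℝ) : EReal) - conj f p) p

lemma mem_subdiff_conj_comm (hf : IsProper f) (hconv : IsConvex f)
    (hlsc : LowerSemicontinuous f) : q ∈ subdiff (conj f) p ↔ p ∈ subdiff f q := by
  simp only [subdiff, Set.mem_ofPred_eq, conj_conj hf hconv hlsc]
  rw [add_comm, dotProduct_comm]

end Biconjugate

section ExchangeOfSubmodular

lemma convex_exchange_image {V : Type*} [AddCommGroup V] [Module ℝ V] (x y δ₁ : V) {D : Set V}
    (hD : Convex ℝ D) : Convex ℝ ((fun δ₂ => (x - (δ₁ - δ₂), y + (δ₁ - δ₂))) '' D) := by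
  have h (δ₂ : V) : (x - δ₁, y + δ₁) + LinearMap.id.prod (-LinearMap.id : V →ₗ[ℝ] V) δ₂ =
      (x - (δ₁ - δ₂), y + (δ₁ - δ₂)) :=
    Prod.ext (sub_add x δ₁ δ₂) (by simp [sub_eq_add_neg, add_assoc])
  simpa only [Set.image_image, h] using
    (hD.linear_image (LinearMap.id.prod (-LinearMap.id : V →ₗ[ℝ] V))).translate (x - δ₁, y + δ₁)

variable {ι : Type*} [Fintype ι] {c : (ι → ℝ) → EReal} {x y δ₁ : ι → ℝ}

lemma conj_add_conj_le_coe (hf : IsProper c) {p p' : ι → ℝ} {b : ℝ}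
    (h : ∀ u ∈ effDom c, ∀ v ∈ effDom c,
      p ⬝ᵥ u - (c u).toReal + (p' ⬝ᵥ v - (c v).toReal) ≤ b) :
    conj c p + conj c p' ≤ b := by
  obtain ⟨u, hu⟩ := hf.2
  have hp : conj c p ≠ ⊤ := (((conj_le_coe_iff hf.1).2 fun v hv =>
    le_sub_iff_add_le.2 (h v hv u hu)).trans_lt (EReal.coe_lt_top _)).ne
  rw [add_comm, ← EReal.le_sub_iff_add_le (Or.inl (conj_ne_bot hf p)) (Or.inl hp),
    ← EReal.coe_toReal hp (conj_ne_bot hf p), ← EReal.coe_sub, conj_le_coe_iff hf.1]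
  intro v hv
  rw [le_sub_comm, ← EReal.coe_le_coe_iff, EReal.coe_toReal hp (conj_ne_bot hf p),
    conj_le_coe_iff hf.1]
  exact fun u hu => le_sub_iff_add_le.2 (h u hu v hv)

lemma exists_conj_add_conj_le (hf : IsProper c) (hconv : IsConvex c)
    (hlsc : LowerSemicontinuous c) {K : Set ((ι → ℝ) × (ι → ℝ))} (hK : IsCompact K)
    (hKc : Convex ℝ K) {M : ℝ} (hMK : ∀ z ∈ K, M < c z.1 + c z.2) :
    ∃ (p p' : ι → ℝ) (b : ℝ), conj c p + conj c p' ≤ b ∧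
      ∀ z ∈ K, M < p ⬝ᵥ z.1 + p' ⬝ᵥ z.2 - b := by
  obtain ⟨x, hx⟩ := hf.2
  obtain ⟨l, b, hle, hlt⟩ := exists_affine_minorant_gt (x := (x, x))
    (convex_epigraph_add_prod hf.1 hconv) (lowerSemicontinuous_add_prod hf.1 hlsc)
    (EReal.add_ne_bot_iff.2 ⟨hf.1 x, hf.1 x⟩) (EReal.add_ne_top hx.ne hx.ne) hK hKc hMK
  obtain ⟨p, hp⟩ := exists_dotProduct_eq (l.comp (.inl ℝ (ι → ℝ) (ι → ℝ)))
  obtain ⟨p', hp'⟩ := exists_dotProduct_eq (l.comp (.inr ℝ (ι → ℝ) (ι → ℝ)))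
  have hl (z : (ι → ℝ) × (ι → ℝ)) : l z = p ⬝ᵥ z.1 + p' ⬝ᵥ z.2 := by
    rw [← hp, ← hp', ← ContinuousLinearMap.comp_inl_add_comp_inr]
  refine ⟨p, p', b, conj_add_conj_le_coe hf fun u hu v hv => ?_, fun z hz => hl z ▸ hlt z hz⟩
  have huv := hle (u, v) _ ((add_le_coe_iff hf.1).2 ⟨hu, hv, le_rfl⟩)
  rw [hl] at huv
  linarith

/-- Take `δ₂ = (x - y)⁻` where `p < p'` and `δ₂ = 0` elsewhere. -/
lemma exists_dotProduct_exchange_le (p p' : ι → ℝ) (hδ₁ : δ₁ ∈ Set.Icc 0 (x - y)⁺) :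
    ∃ δ₂ ∈ Set.Icc 0 (x - y)⁻,
      p ⬝ᵥ (x - (δ₁ - δ₂)) + p' ⬝ᵥ (y + (δ₁ - δ₂)) ≤ (p ⊓ p') ⬝ᵥ y + (p ⊔ p') ⬝ᵥ x := by
  refine ⟨fun i => if p i < p' i then (x i - y i)⁻ else 0, ⟨fun i => ?_, fun i => ?_⟩, ?_⟩
  · positivity
  · simp only [Pi.negPart_apply, Pi.sub_apply]
    split_ifs
    exacts [le_rfl, negPart_nonneg _]
  simp only [dotProduct, ← Finset.sum_add_distrib]
  refine Finset.sum_le_sum fun i _ => ?_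
  have h₀ : 0 ≤ δ₁ i := hδ₁.1 i
  have h₁ : δ₁ i ≤ (x i - y i)⁺ := hδ₁.2 i
  simp only [Pi.inf_apply, Pi.sup_apply, Pi.sub_apply, Pi.add_apply]
  split_ifs with hi
  · rw [inf_eq_left.2 hi.le, sup_eq_right.2 hi.le]
    have hδ : δ₁ i - (x i - y i)⁻ ≤ x i - y i := by
      linarith [posPart_sub_negPart (x i - y i)]
    linarith [mul_le_mul_of_nonneg_left hδ (sub_nonneg.2 hi.le)]
  · rw [inf_eq_right.2 (not_lt.1 hi), sup_eq_left.2 (not_lt.1 hi)]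
    linarith [mul_le_mul_of_nonneg_right (not_lt.1 hi) h₀]

theorem isExchangeable_of_isSubmodular_conj (hf : IsProper c) (hconv : IsConvex c)
    (hlsc : LowerSemicontinuous c) (h : IsSubmodular (conj c)) : IsExchangeable c := by
  intro x hx y hy δ₁ hδ₁
  by_contra! hlt
  obtain ⟨p, p', b, hb, hK⟩ := exists_conj_add_conj_le hf hconv hlsc
    (isCompact_Icc.image (by fun_prop)) (convex_exchange_image x y δ₁ (convex_Icc 0 (x - y)⁻))
    (M := (c x).toReal + (c y).toReal) (by
      rintro _ ⟨δ₂, hδ₂, rfl⟩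
      rw [EReal.coe_add, coe_toReal_of_mem_effDom hf.1 hx, coe_toReal_of_mem_effDom hf.1 hy]
      exact hlt δ₂ hδ₂)
  obtain ⟨hp, hp', -⟩ := (add_le_coe_iff (conj_ne_bot hf)).1 hb
  obtain ⟨hinf, hsup, hle⟩ :=
    (add_le_coe_iff (conj_ne_bot hf)).1 ((h p hp p' hp').trans hb)
  obtain ⟨δ₂, hδ₂, hdot⟩ := exists_dotProduct_exchange_le p p' hδ₁
  have hδ := hK _ ⟨δ₂, hδ₂, rfl⟩
  have hy' := dotProduct_le_conj_add hf hinf hy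
  have hx' := dotProduct_le_conj_add hf hsup hx
  linarith

end ExchangeOfSubmodular

section Demand

variable {ι : Type*} {I : Set ι} {X Y : Set (ι → ℝ)}

lemma extend_zero_mem_Icc {δ : I → ℝ} {v : ι → ℝ} (hδ : δ ∈ Set.Icc 0 fun i : I => v i)
    (hv : 0 ≤ v) : Function.extend Subtype.val δ 0 ∈ Set.Icc 0 v := by
  rw [Set.mem_Icc, Pi.le_def, Pi.le_def, ← forall_and]
  intro i
  by_cases hi : i ∈ I
  · rw [Subtype.val_injective.extend_apply δ 0 ⟨i, hi⟩]
    exact ⟨hδ.1 ⟨i, hi⟩, hδ.2 ⟨i, hi⟩⟩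
  · rw [Function.extend_apply' _ _ _ (by simpa using hi)]
    exact ⟨le_rfl, hv i⟩

lemma setQLE_proj_of_forall (h : ∀ x ∈ X, ∀ y ∈ Y, ∀ δ₁ ∈ Set.Icc 0 (x - y)⁺,
      (∀ i ∉ I, δ₁ i = 0) → ∃ δ₂ ∈ Set.Icc 0 (x - y)⁻,
        x - (δ₁ - δ₂) ∈ X ∧ y + (δ₁ - δ₂) ∈ Y) :
    SetQLE (proj I X) (proj I Y) := by
  rintro _ ⟨x, hx, rfl⟩ _ ⟨y, hy, rfl⟩ δ₁ hδ₁
  obtain ⟨δ₂, hδ₂, hxδ, hyδ⟩ := h x hx y hy (Function.extend Subtype.val δ₁ 0)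
    (extend_zero_mem_Icc hδ₁ (posPart_nonneg _))
    fun i hi => Function.extend_apply' _ _ _ (by simpa using hi)
  have hδ (i : I) : Function.extend Subtype.val δ₁ 0 (i : ι) = δ₁ i :=
    Subtype.val_injective.extend_apply δ₁ 0 i
  refine ⟨fun i => δ₂ i, ⟨fun i => hδ₂.1 i, fun i => hδ₂.2 i⟩,
    ⟨_, hxδ, funext fun i => ?_⟩, ⟨_, hyδ, funext fun i => ?_⟩⟩ <;>
  simp only [Pi.sub_apply, Pi.add_apply, hδ]

lemma SetQLE.of_const_sub_image {a : ι → ℝ}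
    (h : SetQLE ((fun x => a - x) '' Y) ((fun x => a - x) '' X)) : SetQLE X Y := by
  intro x hx y hy δ₁ hδ₁
  obtain ⟨δ₂, hδ₂, ⟨y', hy', hyδ⟩, ⟨x', hx', hxδ⟩⟩ :=
    h _ ⟨y, hy, rfl⟩ _ ⟨x, hx, rfl⟩ δ₁ (by rwa [sub_sub_sub_cancel_left])
  rw [sub_sub_sub_cancel_left] at hδ₂
  exact ⟨δ₂, hδ₂, sub_right_injective (hxδ.trans (sub_add a x _)) ▸ hx',
    sub_right_injective (hyδ.trans (sub_sub a y _)) ▸ hy'⟩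

variable [Fintype ι] {c : (ι → ℝ) → EReal} {p p' b b' q q' : ι → ℝ}

lemma proj_rejected (I : Set ι) (c : (ι → ℝ) → EReal) (p b : ι → ℝ) :
    proj I (rejected c p b) =
      (fun z => (fun i : I => b i) - z) '' proj I (demand c p b) := by
  simp only [proj, rejected, Set.image_image]
  rfl

lemma mem_demand_iff (hbot : ∀ x, c x ≠ ⊥) :
    q ∈ demand c p b ↔ q ≤ b ∧ q ∈ effDom c ∧
      ∀ v ∈ effDom c, v ≤ b → p ⬝ᵥ v - (c v).toReal ≤ p ⬝ᵥ q - (c q).toReal := by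
  refine and_congr_right fun _ => and_congr_right fun hq => forall_congr' fun v => ?_
  rw [← coe_toReal_of_mem_effDom hbot hq, ← EReal.coe_sub]
  by_cases hv : v ∈ effDom c
  · rw [← coe_toReal_of_mem_effDom hbot hv, ← EReal.coe_sub, EReal.coe_le_coe_iff]
    simp [hv]
  · simp [eq_top_of_notMem_effDom hv, hv]

lemma mem_subdiff_iff_forall_sub_le (hf : IsProper c) :
    p ∈ subdiff c q ↔ q ∈ effDom c ∧
      ∀ v ∈ effDom c, p ⬝ᵥ v - (c v).toReal ≤ p ⬝ᵥ q - (c q).toReal := by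
  rw [mem_subdiff_iff hf]
  refine and_congr_right fun _ => forall₂_congr fun v _ => ?_
  rw [dotProduct_sub]
  constructor <;> intro h <;> linarith

lemma demand_eq_setOf_mem_subdiff (hf : IsProper c) (hp : p ∈ subdiff c q) (hqb : q ≤ b) :
    demand c p b = {v | v ≤ b ∧ p ∈ subdiff c v} := by
  rw [mem_subdiff_iff_forall_sub_le hf] at hp
  ext v
  rw [mem_demand_iff hf.1, Set.mem_ofPred_eq, mem_subdiff_iff_forall_sub_le hf]
  refine and_congr_right fun _ => and_congr_right fun _ =>
    ⟨fun h u hu => (hp.2 u hu).trans (h q hp.1 hqb), fun h u hu _ => h u hu⟩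

lemma mem_demand_of_surplus_le (hbot : ∀ x, c x ≠ ⊥) (hq : q ∈ demand c p b)
    (hq' : q' ∈ demand c p' b') {u u' : ι → ℝ} (hu : u ∈ effDom c) (hu' : u' ∈ effDom c)
    (hub : u ≤ b) (hub' : u' ≤ b')
    (h : p ⬝ᵥ q - (c q).toReal + (p' ⬝ᵥ q' - (c q').toReal)
      ≤ p ⬝ᵥ u - (c u).toReal + (p' ⬝ᵥ u' - (c u').toReal)) :
    u ∈ demand c p b ∧ u' ∈ demand c p' b' := by
  simp only [mem_demand_iff hbot] at hq hq' ⊢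
  have huq := hq.2.2 u hu hub
  have huq' := hq'.2.2 u' hu' hub'
  exact ⟨⟨hub, hu, fun v hv hvb => (hq.2.2 v hv hvb).trans (by linarith)⟩,
    ⟨hub', hu', fun v hv hvb => (hq'.2.2 v hv hvb).trans (by linarith)⟩⟩

lemma IsExchangeable.exists_surplus_le (h : IsExchangeable c) (hbot : ∀ x, c x ≠ ⊥)
    (hpp' : p ≤ p') (hq : q ∈ effDom c) (hq' : q' ∈ effDom c) {δ₁ : ι → ℝ}
    (hδ₁ : δ₁ ∈ Set.Icc 0 (q' - q)⁺) (hsupp : ∀ i ∉ agree p p', δ₁ i = 0) :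
    ∃ δ₂ ∈ Set.Icc 0 (q' - q)⁻, q + (δ₁ - δ₂) ∈ effDom c ∧ q' - (δ₁ - δ₂) ∈ effDom c ∧
      p ⬝ᵥ q - (c q).toReal + (p' ⬝ᵥ q' - (c q').toReal)
        ≤ p ⬝ᵥ (q + (δ₁ - δ₂)) - (c (q + (δ₁ - δ₂))).toReal
          + (p' ⬝ᵥ (q' - (δ₁ - δ₂)) - (c (q' - (δ₁ - δ₂))).toReal) := by
  obtain ⟨δ₂, hδ₂, hqδ', hqδ, hle⟩ := (isExchangeable_iff hbot).1 h q' hq' q hq δ₁ hδ₁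
  refine ⟨δ₂, hδ₂, hqδ, hqδ', ?_⟩
  have hdot : 0 ≤ (p' - p) ⬝ᵥ (δ₂ - δ₁) := by
    refine Finset.sum_nonneg fun i _ => ?_
    by_cases hi : i ∈ agree p p'
    · rw [Pi.sub_apply, show p i = p' i from hi, sub_self, zero_mul]
    · rw [Pi.sub_apply δ₂, hsupp i hi, sub_zero]
      exact mul_nonneg (sub_nonneg.2 (hpp' i)) (hδ₂.1 i)
  simp only [sub_dotProduct, dotProduct_sub, dotProduct_add] at hdot ⊢
  linarith

theorem IsExchangeable.setQLE_rejected (h : IsExchangeable c) (hbot : ∀ x, c x ≠ ⊥)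
    (hpp' : p ≤ p') (hbb' : b ≤ b') :
    SetQLE (proj (agree p p') (rejected c p b)) (proj (agree p p') (rejected c p' b')) := by
  refine setQLE_proj_of_forall ?_
  rintro _ ⟨q, hq, rfl⟩ _ ⟨q', hq', rfl⟩ δ₁ hδ₁ hsupp
  have hdiff : b - q - (b' - q') ≤ q' - q := by
    rw [sub_sub_sub_comm]
    simpa [sub_sub_eq_add_sub] using hbb'
  have hδ₁q : δ₁ ≤ b - q :=
    hδ₁.2.trans (sup_le (sub_le_self _ (sub_nonneg.2 hq'.1)) (sub_nonneg.2 hq.1))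
  obtain ⟨δ₂, hδ₂, hu, hu', hle⟩ := h.exists_surplus_le hbot hpp' hq.2.1 hq'.2.1
    ⟨hδ₁.1, hδ₁.2.trans (posPart_mono hdiff)⟩ hsupp
  have hub : q + (δ₁ - δ₂) ≤ b :=
    le_sub_iff_add_le'.1 ((sub_le_self _ hδ₂.1).trans hδ₁q)
  have hub' : q' - (δ₁ - δ₂) ≤ b' := calc
    q' - (δ₁ - δ₂) ≤ q' + (q' - q)⁻ := by
      rw [sub_sub_eq_add_sub, add_sub_assoc]
      gcongr
      exact (sub_le_self _ hδ₁.1).trans hδ₂.2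
    _ = q ⊔ q' := by rw [← posPart_neg, neg_sub, sup_eq_add_posPart_sub]
    _ ≤ b' := sup_le (hq.1.trans hbb') hq'.1
  obtain ⟨hd, hd'⟩ := mem_demand_of_surplus_le hbot hq hq' hu hu' hub hub' hle
  exact ⟨δ₂, ⟨hδ₂.1, hδ₂.2.trans (negPart_anti hdiff)⟩, ⟨_, hd, sub_add_eq_sub_sub _ _ _⟩,
    ⟨_, hd', (sub_add _ _ _).symm⟩⟩

theorem subdiffExchangeable_conj_of_setQLE_rejected (hf : IsProper c) (hconv : IsConvex c)
    (hlsc : LowerSemicontinuous c) (h : ∀ p p' b : ι → ℝ, p ≤ p' →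
      SetQLE (proj (agree p p') (rejected c p b)) (proj (agree p p') (rejected c p' b))) :
    SubdiffExchangeable (conj c) := by
  rintro p p' hpp' _ ⟨x, hx, rfl⟩ _ ⟨y, hy, rfl⟩ δ₁ hδ₁
  have hdemand {p q : ι → ℝ} (hq : q ∈ subdiff (conj c) p) (hqb : q ≤ x ⊔ y) :
      demand c p (x ⊔ y) = {v | v ≤ x ⊔ y ∧ v ∈ subdiff (conj c) p} := by
    simp only [mem_subdiff_conj_comm hf hconv hlsc] at hq ⊢
    exact demand_eq_setOf_mem_subdiff hf hq hqb
  have hb := h p p' (x ⊔ y) hpp'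
  rw [proj_rejected, proj_rejected, hdemand hx le_sup_left, hdemand hy le_sup_right] at hb
  obtain ⟨δ₂, hδ₂, ⟨x', hx', hxδ⟩, ⟨y', hy', hyδ⟩⟩ := hb.of_const_sub_image
    _ ⟨x, ⟨le_sup_left, hx⟩, rfl⟩ _ ⟨y, ⟨le_sup_right, hy⟩, rfl⟩ δ₁ hδ₁
  exact ⟨δ₂, hδ₂, ⟨x', hx'.2, hxδ⟩, ⟨y', hy'.2, hyδ⟩⟩

end Demand

end ExchangeMCS

theorem mainTheorem1_general {ι : Type*} [Fintype ι] (c : (ι → ℝ) → EReal)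
    (hproper : ExchangeMCS.IsProper c) (hconvex : ExchangeMCS.IsConvex c)
    (hlsc : LowerSemicontinuous c) :
    List.TFAE [
      ExchangeMCS.IsExchangeable c,
      ExchangeMCS.IsSubmodular (ExchangeMCS.conj c),
      ∀ p p' : ι → ℝ, p ≤ p' →
        ExchangeMCS.SetQLE
          (ExchangeMCS.proj (ExchangeMCS.agree p p')
            (ExchangeMCS.subdiff (ExchangeMCS.conj c) p'))
          (ExchangeMCS.proj (ExchangeMCS.agree p p')
            (ExchangeMCS.subdiff (ExchangeMCS.conj c) p)),
      ∀ p qbar p' qbar' : ι → ℝ, p ≤ p' → qbar ≤ qbar' →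
        ExchangeMCS.SetQLE
          (ExchangeMCS.proj (ExchangeMCS.agree p p') (ExchangeMCS.rejected c p qbar))
          (ExchangeMCS.proj (ExchangeMCS.agree p p') (ExchangeMCS.rejected c p' qbar'))] := by
  tfae_have 2 → 1 := ExchangeMCS.isExchangeable_of_isSubmodular_conj hproper hconvex hlsc
  tfae_have 1 → 4 := fun h _ _ _ _ => h.setQLE_rejected hproper.1
  tfae_have 4 → 3 := fun h =>
    ExchangeMCS.subdiffExchangeable_conj_of_setQLE_rejected hproper hconvex hlsc
      fun p p' b hpp' => h p b p' b hpp' le_rfl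
  tfae_have 3 → 2 := fun h =>
    ExchangeMCS.SubdiffExchangeable.isSubmodular h
      (ExchangeMCS.conj_isProper hproper hconvex hlsc)
      (ExchangeMCS.conj_isConvex hproper.1)
      (ExchangeMCS.conj_lowerSemicontinuous hproper.1)
  tfae_finish

theorem mainTheorem1 (n : ℕ) (c : (Fin n → ℝ) → EReal)
    (hproper : ExchangeMCS.IsProper c) (hconvex : ExchangeMCS.IsConvex c)
    (hlsc : LowerSemicontinuous c) :
    List.TFAE [
      ExchangeMCS.IsExchangeable c,
      ExchangeMCS.IsSubmodular (ExchangeMCS.conj c),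
      ∀ p p' : Fin n → ℝ, p ≤ p' →
        ExchangeMCS.SetQLE
          (ExchangeMCS.proj (ExchangeMCS.agree p p')
            (ExchangeMCS.subdiff (ExchangeMCS.conj c) p'))
          (ExchangeMCS.proj (ExchangeMCS.agree p p')
            (ExchangeMCS.subdiff (ExchangeMCS.conj c) p)),
      ∀ p qbar p' qbar' : Fin n → ℝ, p ≤ p' → qbar ≤ qbar' →
        ExchangeMCS.SetQLE
          (ExchangeMCS.proj (ExchangeMCS.agree p p') (ExchangeMCS.rejected c p qbar))
          (ExchangeMCS.proj (ExchangeMCS.agree p p') (ExchangeMCS.rejected c p' qbar'))] :=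
  mainTheorem1_general c hproper hconvex hlsc
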